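/- Let $L$ be a first-order language, let $\kappa>|L|+\aleph_0$ be a cardinal and let $\mathcal U$ be a $\kappa$-saturated $L$-structure (the monster model; "small" means of cardinality $<\kappa$; for a saturated $\mathcal U$ one may take $\kappa=|\mathcal U|$). For $A\subseteq\mathcal U$ and a tuple of variables $x$, a Keisler measure over $A$ in $x$ is a finitely additive probability measure on the Boolean algebra of $A$-definable subsets of $\mathcal U^{x}$; it is global if $A=\mathcal U$. A Keisler measure $\mu$ over a small elementary submodel $M\prec\mathcal U$ is smooth if it has a unique extension to a global Keisler measure. If $M\prec\mathcal U$ is not necessarily small, $\mu$ over $M$ is called smooth if it has a unique global extension and, moreover, its restriction to some small $M_0\prec\mathcal U$ with $M_0\subseteq M$ already has a unique global extension (for small $M$ the two definitions agree). If $\mu_x,\nu_y,\omega_{xy}$ are Keisler measures over $M$, then $\omega$ is a separated amalgam of $\mu$ and $\nu$ if $\omega(\varphi(x)\wedge\psi(y))=\mu(\varphi(x))\,\nu(\psi(y))$ for all $\varphi(x),\psi(y)\in L(M)$. Let $M\prec\mathcal U$ be an elementary submodel, not necessarily small, and let $\mu_x,\nu_y$ be Keisler measures over $M$, where $x$ and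 $y$ are disjoint, possibly infinite, tuples of variables. Assume that $\mu$ is smooth. Then there is a unique separated amalgam of $\mu$ and $\nu$ over $M$, denoted $\mu\times\nu$. If moreover $\nu$ is smooth, then $\mu\times\nu$ is smooth. -/

import Mathlib

universe u v w

namespace FirstOrder.Language

/-- `U` is `κ`-saturated: for every parameter set `A ⊆ U` of cardinality `< κ`, every finitely
satisfiable set of `L(A)`-formulas in finitely many variables is realized in `U`. -/
def IsSaturated (L : Language.{u, v}) (U : Type w) [L.Structure U] (κ : Cardinal.{w}) : Prop :=
  ∀ A : Set U, Cardinal.mk A < κ →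
    ∀ (n : ℕ) (p : Set (L[[A]].Formula (Fin n))),
      (∀ q : Finset (L[[A]].Formula (Fin n)), (q : Set (L[[A]].Formula (Fin n))) ⊆ p →
        ∃ a : Fin n → U, ∀ φ ∈ q, φ.Realize a) →
      ∃ a : Fin n → U, ∀ φ ∈ p, φ.Realize a

/-- A Keisler measure over `A ⊆ U` in the tuple of variables indexed by `α`: a finitely additive
probability measure on the Boolean algebra of `A`-definable subsets of `α → U`. -/
@[ext]
structure KeislerMeasure (L : Language.{u, v}) {U : Type w} [L.Structure U] (A : Set U)
    (α : Type*) where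
  toFun : L.DefinableSet A α → ℝ
  nonneg' : ∀ s, 0 ≤ toFun s
  top' : toFun ⊤ = 1
  sup' : ∀ s t, Disjoint s t → toFun (s ⊔ t) = toFun s + toFun t

/-- An `A`-definable set, seen as a `B`-definable set for `A ⊆ B`. -/
def DefinableSet.ofSubset {L : Language.{u, v}} {U : Type w} [L.Structure U] {A B : Set U}
    {α : Type*} (h : A ⊆ B) (s : L.DefinableSet A α) : L.DefinableSet B α :=
  ⟨s.1, s.2.mono h⟩

/-- The set of pairs `(x, y)` with `x ∈ s` and `y ∈ t`: if `φ(x)` and `ψ(y)` define `s` and `t`,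
this is the set defined by `φ(x) ∧ ψ(y)`. -/
def DefinableSet.rectangle {L : Language.{u, v}} {U : Type w} [L.Structure U] {A : Set U}
    {α β : Type*} (s : L.DefinableSet A α) (t : L.DefinableSet A β) :
    L.DefinableSet A (α ⊕ β) :=
  ⟨{z | z ∘ Sum.inl ∈ s ∧ z ∘ Sum.inr ∈ t},
    (s.2.preimage_comp Sum.inl).inter (t.2.preimage_comp Sum.inr)⟩

namespace KeislerMeasure

variable {L : Language.{u, v}} {U : Type w} [L.Structure U]

instance {A : Set U} {α : Type*} :
    CoeFun (KeislerMeasure L A α) (fun _ => L.DefinableSet A α → ℝ) :=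
  ⟨KeislerMeasure.toFun⟩

/-- The restriction to `A` of a Keisler measure over `B ⊇ A`. -/
def restrict {A B : Set U} {α : Type*} (h : A ⊆ B) (μ : KeislerMeasure L B α) :
    KeislerMeasure L A α where
  toFun s := μ (s.ofSubset h)
  nonneg' _ := μ.nonneg' _
  top' := μ.top'
  sup' s t hst := by
    refine μ.sup' (s.ofSubset h) (t.ofSubset h) ?_
    rw [disjoint_iff] at hst ⊢
    exact SetLike.coe_injective (congrArg (fun r : L.DefinableSet A α => (r : Set (α → U))) hst)

/-- `μ` has exactly one extension to a global Keisler measure, i.e. one over all of `U`. -/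
def HasUniqueGlobalExtension {A : Set U} {α : Type*} (μ : KeislerMeasure L A α) : Prop :=
  ∃! μ' : KeislerMeasure L (Set.univ : Set U) α, μ'.restrict (Set.subset_univ A) = μ

/-- Smoothness of a measure over an elementary submodel `M` of `U`, which need not be small (small
means of cardinality `< κ`). For small `M` it means that `μ` has a unique global extension
(see `isSmooth_iff_of_small`). For large `M` that condition alone would be too weak, and void for
`M = U`: there, `μ` is smooth if moreover its restriction to some small elementary submodel `M₀`
contained in `M` has a unique global extension. -/
def IsSmooth (κ : Cardinal.{w}) {M : L.ElementarySubstructure U} {α : Type*}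
    (μ : KeislerMeasure L (M : Set U) α) : Prop :=
  μ.HasUniqueGlobalExtension ∧
    ∃ (M₀ : L.ElementarySubstructure U) (h : (M₀ : Set U) ⊆ (M : Set U)),
      Cardinal.mk M₀ < κ ∧ (μ.restrict h).HasUniqueGlobalExtension

theorem isSmooth_iff_of_small {κ : Cardinal.{w}} {M : L.ElementarySubstructure U}
    (hM : Cardinal.mk M < κ) {α : Type*} (μ : KeislerMeasure L (M : Set U) α) :
    μ.IsSmooth κ ↔ μ.HasUniqueGlobalExtension :=
  ⟨fun h => h.1, fun h => ⟨h, M, subset_rfl, hM, h⟩⟩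

/-- `ω` is a separated amalgam of `μ` and `ν`: `ω(φ(x) ∧ ψ(y)) = μ(φ(x)) ν(ψ(y))`. -/
def IsSeparatedAmalgam {A : Set U} {α β : Type*} (μ : KeislerMeasure L A α)
    (ν : KeislerMeasure L A β) (ω : KeislerMeasure L A (α ⊕ β)) : Prop :=
  ∀ (s : L.DefinableSet A α) (t : L.DefinableSet A β), ω (s.rectangle t) = μ s * ν t

end KeislerMeasure

end FirstOrder.Language

/-!
A Keisler measure is a positive linear functional on formal combinations of definable sets, so the
Riesz extension theorem applies. It yields the separated amalgam as an extension of the functional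
`∑ cᵢ (sᵢ × tᵢ) ↦ ∑ cᵢ μ(sᵢ) ν(tᵢ)`, whose positivity is seen by integrating first in `x`, then in
`y`. It also gives the theorem of Łoś and Marczewski: any value between the inner and the outer
measure of a set `D` is taken at `D` by some extension. A measure with a unique global extension
therefore approximates each global definable set from inside and outside up to `ε`.

Let `μ` have a unique global extension already over a small set, and let `E` be definable in
`(x, y)`. Each fibre `E_y` lies between sets `s` and `t`, definable over the small set, with
`μ(t) - μ(s) < ε`. That a given pair works for `y` is a definable condition on `y`, so by saturation
finitely many pairs suffice. The resulting finite partition in `y` bounds `ω(E)`, for any separated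
amalgam `ω`, between sums depending only on `μ` and `ν` that differ by at most `ε`. Hence `ω` is
unique.

When `ν` is smooth as well, approximation in each coordinate shows that any global extension of a
separated amalgam is the separated amalgam of the global extensions of `μ` and `ν`, hence unique.
Löwenheim–Skolem provides a small model inside `M` over which all of this can be carried out.
-/

open Set

theorem exists_linearMap_nonneg_extension {V W F : Type*} [AddCommGroup V] [Module ℝ V]
    [AddCommGroup W] [Module ℝ W] [AddCommGroup F] [PartialOrder F] [IsOrderedAddMonoid F]
    [Module ℝ F] [PosSMulMono ℝ F] (e : V →ₗ[ℝ] F) (d : W →ₗ[ℝ] F) (I : V →ₗ[ℝ] ℝ)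
    (hI : ∀ v, 0 ≤ e v → 0 ≤ I v) (hdom : ∀ w, ∃ v, d w ≤ e v) :
    ∃ J : W →ₗ[ℝ] ℝ, (∀ w, 0 ≤ d w → 0 ≤ J w) ∧ ∀ v w, e v = d w → I v = J w := by
  -- On `V × W` there is no need to check that `I` factors through `e`.
  let f : V × W →ₗ.[ℝ] ℝ :=
    ⟨LinearMap.range (LinearMap.inl ℝ V W), (I ∘ₗ LinearMap.fst ℝ V W).domRestrict _⟩
  obtain ⟨g, hgf, hg⟩ := riesz_extension ((PointedCone.positive ℝ F).comap (e.coprod d)) f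
    (by
      rintro ⟨_, v, rfl⟩ hv
      exact hI v (by simpa using hv))
    (by
      rintro ⟨v, w⟩
      obtain ⟨v', hv'⟩ := hdom (-w)
      refine ⟨⟨(v' - v, 0), v' - v, rfl⟩, ?_⟩
      simpa [neg_le_iff_add_nonneg] using hv')
  have hg_nonneg (v : V) (w : W) (h : 0 ≤ e v + d w) : 0 ≤ g (v, w) := hg _ (by simpa using h)
  have hg_apply (v : V) (w : W) : g (v, w) = I v + (g ∘ₗ LinearMap.inr ℝ V W) w := by
    rw [← show g (v, 0) = I v from hgf ⟨(v, 0), v, rfl⟩, LinearMap.comp_apply,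
      LinearMap.inr_apply, ← map_add, Prod.mk_add_mk, add_zero, zero_add]
  refine ⟨g ∘ₗ LinearMap.inr ℝ V W, fun w hw => hg_nonneg 0 w (by simpa using hw),
    fun v w h => ?_⟩
  have hle := hg_nonneg (-v) w (by simp [h])
  have hge := hg_nonneg v (-w) (by simp [h])
  rw [hg_apply, map_neg] at hle hge
  linarith

theorem induction_of_le_finset_sup {ι B : Type*} [GeneralizedBooleanAlgebra B] {P : B → Prop}
    (bot : P ⊥) (disjoint_sup : ∀ s t, Disjoint s t → P s → P t → P (s ⊔ t)) {F : Finset ι}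
    {Q : ι → B} (le : ∀ i ∈ F, ∀ t ≤ Q i, P t) {t : B} (ht : t ≤ F.sup Q) : P t := by
  classical
  induction F using Finset.induction generalizing t with
  | empty => rwa [le_bot_iff.1 ht]
  | insert i F _ ih =>
    rw [Finset.sup_insert] at ht
    rw [← sup_inf_sdiff t (Q i)]
    exact disjoint_sup _ _ disjoint_inf_sdiff
      (le i (Finset.mem_insert_self i F) _ inf_le_right)
      (ih (fun j hj => le j (Finset.mem_insert_of_mem hj)) (sdiff_le_iff.2 ht))

section Definability

open FirstOrder FirstOrder.Language

variable {L : FirstOrder.Language.{u, v}} {U : Type w} [L.Structure U] {A : Set U} {α β : Type*}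

theorem exists_finset_preimage_eq_of_definable {W : Set (α ⊕ β → U)} (hW : A.Definable L W) :
    ∃ (S : Finset α) (T : Finset β) (W' : Set (S ⊕ T → U)), A.Definable L W' ∧
      (fun z => z ∘ Sum.map (↑) (↑)) ⁻¹' W' = W := by
  classical
  obtain ⟨φ, rfl⟩ := hW
  refine ⟨φ.freeVarFinset.toLeft, φ.freeVarFinset.toRight, _, ⟨φ.restrictFreeVar fun x =>
    Sum.casesOn x.1 (fun a ha => Sum.inl ⟨a, by simpa using ha⟩)
      (fun b hb => Sum.inr ⟨b, by simpa using hb⟩) x.2, rfl⟩, ?_⟩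
  ext z
  refine BoundedFormula.realize_restrictFreeVar _ ?_
  rintro ⟨a | b, h⟩ <;> rfl

theorem definable_setOf_forall_sumElim_mem {W : Set (α ⊕ β → U)} (hW : A.Definable L W) :
    A.Definable L {y : β → U | ∀ x : α → U, Sum.elim x y ∈ W} := by
  obtain hα | ⟨⟨x₀⟩⟩ := isEmpty_or_nonempty (α → U)
  · simpa only [IsEmpty.forall_iff, ofPred_true] using definable_univ
  obtain ⟨S, T, W', hW', rfl⟩ := exists_finset_preimage_eq_of_definable hW
  convert! (hW'.preimage_comp Sum.swap).forall_of_finite.preimage_comp ((↑) : T → β) using 1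
  ext y
  simp only [mem_ofPred_eq, mem_preimage, Sum.elim_swap, Sum.elim_comp_map]
  refine ⟨fun h u => ?_, fun h x => h (x ∘ (↑))⟩
  have hu := h (Function.extend (↑) u x₀)
  rwa [Function.extend_comp Subtype.val_injective] at hu

theorem definable_univ_setOf_sumElim_mem {W : Set (α ⊕ β → U)} (hW : A.Definable L W)
    (y : β → U) : (univ : Set U).Definable L {x : α → U | Sum.elim x y ∈ W} := by
  rw [definable_iff_exists_formula_sum] at hW ⊢
  obtain ⟨φ, rfl⟩ := hW
  refine ⟨φ.relabel (Sum.elim (fun a : A => Sum.inl ⟨a, mem_univ _⟩)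
    (Sum.elim Sum.inr fun b => Sum.inl ⟨y b, mem_univ _⟩)), ?_⟩
  ext x
  simp only [mem_ofPred_eq, Formula.realize_relabel]
  refine iff_of_eq (congrArg _ ?_)
  ext (a | a | b) <;> rfl

/-- The parameters `y` for which the fibre `{x | (x, y) ∈ W}` lies between `s` and `t`; if `θ(x)`,
`θ'(x)` and `φ(x, y)` define `s`, `t` and `W`, it is defined by
`∀ x, (θ(x) → φ(x, y)) ∧ (φ(x, y) → θ'(x))`. -/
def fiberBetween (s t : Set (α → U)) (W : Set (α ⊕ β → U)) : Set (β → U) :=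
  {y | ∀ x, (x ∈ s → Sum.elim x y ∈ W) ∧ (Sum.elim x y ∈ W → x ∈ t)}

theorem definable_fiberBetween {s t : Set (α → U)} {W : Set (α ⊕ β → U)} (hs : A.Definable L s)
    (ht : A.Definable L t) (hW : A.Definable L W) : A.Definable L (fiberBetween s t W) := by
  have hsW := (hs.preimage_comp (Sum.inl : α → α ⊕ β)).himp hW
  have hWt := hW.himp (ht.preimage_comp (Sum.inl : α → α ⊕ β))
  exact definable_setOf_forall_sumElim_mem (hsW.inter hWt)

end Definability

theorem FirstOrder.Language.IsSaturated.exists_finset_cover {L : FirstOrder.Language.{u, v}}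
    {U : Type w} [L.Structure U] {κ : Cardinal.{w}} (hU : L.IsSaturated U κ) {A : Set U}
    (hA : Cardinal.mk A < κ) {τ ι : Type*} [Finite τ] {Q : ι → Set (τ → U)}
    (hQ : ∀ i, A.Definable L (Q i)) (hcover : ∀ y, ∃ i, y ∈ Q i) :
    ∃ F : Finset ι, ∀ y, ∃ i ∈ F, y ∈ Q i := by
  classical
  obtain ⟨n, ⟨f⟩⟩ := Finite.exists_equiv_fin τ
  choose ψ hψ using fun i => (hQ i).preimage_comp f
  have realize_iff (i : ι) (a : Fin n → U) : (ψ i).Realize a ↔ a ∘ f ∈ Q i :=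
    (Set.ext_iff.1 (hψ i) a).symm
  by_contra! hF
  obtain ⟨a, ha⟩ := hU A hA n (range fun i => (ψ i).not) fun q hq => by
    rw [← image_univ, Finset.subset_set_image_iff] at hq
    obtain ⟨F, -, rfl⟩ := hq
    obtain ⟨y, hy⟩ := hF F
    refine ⟨y ∘ f.symm, Finset.forall_mem_image.2 fun i hi => ?_⟩
    rw [Formula.realize_not, realize_iff, Function.comp_assoc, f.symm_comp_self]
    exact hy i hi
  obtain ⟨i, hi⟩ := hcover (a ∘ f)
  exact Formula.realize_not.1 (ha _ (mem_range_self i)) ((realize_iff i a).2 hi)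

section ElementarySubstructure

open FirstOrder FirstOrder.Language

variable {L : FirstOrder.Language.{u, v}} {U : Type w} [L.Structure U]

theorem exists_elementarySubstructure_coe_eq_range {N : Type*} [L.Structure N] (f : N ↪ₑ[L] U) :
    ∃ S : L.ElementarySubstructure U, (S : Set U) = range f := by
  let e := f.toEmbedding.equivRange
  refine ⟨⟨f.toEmbedding.toHom.range, fun n φ x => ?_⟩, rfl⟩
  obtain ⟨y, rfl⟩ : ∃ y : Fin n → N, x = e ∘ y :=
    ⟨e.symm ∘ x, funext fun i => (e.apply_symm_apply (x i)).symm⟩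
  exact (f.map_formula φ y).trans (StrongHomClass.realize_formula e φ).symm

theorem exists_small_elementarySubstructure_between {κ : Cardinal.{w}}
    (hκ : Cardinal.aleph0 < κ) (hL : Cardinal.lift.{w} L.card < Cardinal.lift.{max u v} κ)
    (M : L.ElementarySubstructure U) {s : Set U} (hsM : s ⊆ M) (hs : Cardinal.mk s < κ) :
    ∃ N : L.ElementarySubstructure U, s ⊆ N ∧ (N : Set U) ⊆ M ∧ Cardinal.mk N < κ := by
  obtain hM | hM := lt_or_ge (Cardinal.mk M) κ
  · exact ⟨M, hsM, subset_rfl, hM⟩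
  obtain ⟨c, hc⟩ := Cardinal.mem_range_lift_of_le hL.le
  rw [← hc, Cardinal.lift_lt] at hL
  let c' := max Cardinal.aleph0 (max (Cardinal.mk s) c)
  have hc'κ : c' < κ := max_lt hκ (max_lt hs hL)
  have hs' : Cardinal.mk (Subtype.val ⁻¹' s : Set M) ≤ c' :=
    (Cardinal.mk_preimage_of_injective _ _ Subtype.val_injective).trans
      (le_max_of_le_right (le_max_left _ _))
  have hcc' : c ≤ c' := le_max_of_le_right (le_max_right _ _)
  obtain ⟨S, hS, hcard⟩ := exists_elementarySubstructure_card_eq L (Subtype.val ⁻¹' s : Set M) c'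
    (le_max_left _ _) (Cardinal.lift_le.2 hs') (hc ▸ Cardinal.lift_le.2 hcc')
    (Cardinal.lift_le.2 (hc'κ.le.trans hM))
  obtain ⟨N, hN⟩ := exists_elementarySubstructure_coe_eq_range (M.subtype.comp S.subtype)
  refine ⟨N, ?_, ?_, ?_⟩
  · exact hN ▸ fun x hx => ⟨⟨⟨x, hsM hx⟩, hS hx⟩, rfl⟩
  · exact hN ▸ range_subset_iff.2 fun x => x.1.2
  · calc
      Cardinal.mk (N : Set U) = Cardinal.mk S :=
        hN ▸ Cardinal.mk_range_eq _ (M.subtype.comp S.subtype).injective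
      _ = c' := Cardinal.lift_injective hcard
      _ < κ := hc'κ

end ElementarySubstructure

namespace FirstOrder.Language.KeislerMeasure

open DefinableSet

variable {L : Language.{u, v}} {U : Type w} [L.Structure U] {A B : Set U} {α β : Type*}

section Basic

variable (μ : KeislerMeasure L A α)

theorem apply_bot : μ ⊥ = 0 := by
  have h := μ.sup' ⊥ ⊥ disjoint_bot_left
  rw [sup_idem] at h
  linarith

theorem apply_inf_add_apply_sdiff (s t : L.DefinableSet A α) : μ (s ⊓ t) + μ (s \ t) = μ s := by
  rw [← μ.sup' _ _ disjoint_inf_sdiff, sup_inf_sdiff]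

theorem apply_compl (s : L.DefinableSet A α) : μ sᶜ = 1 - μ s := by
  rw [eq_sub_iff_add_eq', ← μ.sup' _ _ disjoint_compl_right, sup_compl_eq_top, μ.top']

theorem apply_mono : Monotone μ := fun s t h => by
  rw [← μ.apply_inf_add_apply_sdiff t s, inf_eq_right.2 h]
  exact le_add_of_nonneg_right (μ.nonneg' _)

theorem apply_le_one (s : L.DefinableSet A α) : μ s ≤ 1 :=
  μ.top' ▸ μ.apply_mono le_top

end Basic

section SimpleFunction

/-- The real function `x ↦ ∑ i, cᵢ 1_{sᵢ}(x)` represented by the formal linear combination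
`∑ i, cᵢ sᵢ` of definable sets. Formal combinations make its integral well-defined by
construction. -/
noncomputable def simpleFunction : (L.DefinableSet A α →₀ ℝ) →ₗ[ℝ] (α → U) → ℝ :=
  Finsupp.linearCombination ℝ fun s => (s : Set (α → U)).indicator 1

@[simp]
theorem simpleFunction_single (s : L.DefinableSet A α) (c : ℝ) :
    simpleFunction (Finsupp.single s c) = c • (s : Set (α → U)).indicator 1 :=
  Finsupp.linearCombination_single ℝ c s

theorem definable_simpleFunction_preimage (v : L.DefinableSet A α →₀ ℝ) (R : Set ℝ) :
    A.Definable L (simpleFunction v ⁻¹' R) := by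
  classical
  induction v using Finsupp.induction generalizing R with
  | zero =>
    rw [map_zero, Pi.zero_def, preimage_const]
    split_ifs
    exacts [definable_univ, definable_empty]
  | single_add s c v _ _ ih =>
    convert! (s.2.inter (ih ((c + ·) ⁻¹' R))).union (s.2.compl.inter (ih R)) using 1
    ext x
    by_cases hx : x ∈ s.1
    · have hx' : x ∈ (s : Set (α → U)) := hx
      simp [hx, hx']
    · have hx' : x ∉ (s : Set (α → U)) := hx
      simp [hx, hx']

theorem exists_simpleFunction_le (w : L.DefinableSet A α →₀ ℝ) :
    ∃ c : ℝ, simpleFunction w ≤ c • 1 := by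
  induction w using Finsupp.induction_linear with
  | zero => exact ⟨0, by simp⟩
  | add w w' h h' =>
    obtain ⟨c, hc⟩ := h
    obtain ⟨c', hc'⟩ := h'
    exact ⟨c + c', by simpa only [map_add, add_smul] using add_le_add hc hc'⟩
  | single s c =>
    refine ⟨|c|, fun x => ?_⟩
    by_cases hx : x ∈ (s : Set (α → U)) <;> simp [hx, le_abs_self]

end SimpleFunction

section Integral

variable (μ : KeislerMeasure L A α)

/-- The integral against `μ` of the simple function represented by a formal linear combination of
definable sets. -/
noncomputable def integral : (L.DefinableSet A α →₀ ℝ) →ₗ[ℝ] ℝ :=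
  Finsupp.linearCombination ℝ μ

@[simp]
theorem integral_single (s : L.DefinableSet A α) (c : ℝ) :
    μ.integral (Finsupp.single s c) = c * μ s :=
  Finsupp.linearCombination_single ℝ c s

/-- The integral over `t` of the simple function represented by a formal linear combination of
definable sets. -/
noncomputable def setIntegral (t : L.DefinableSet A α) : (L.DefinableSet A α →₀ ℝ) →ₗ[ℝ] ℝ :=
  Finsupp.linearCombination ℝ fun s => μ (s ⊓ t)

@[simp]
theorem setIntegral_single (t s : L.DefinableSet A α) (c : ℝ) :
    μ.setIntegral t (Finsupp.single s c) = c * μ (s ⊓ t) :=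
  Finsupp.linearCombination_single ℝ c s

theorem setIntegral_top : μ.setIntegral ⊤ = μ.integral := by
  simp only [setIntegral, integral, inf_top_eq]

theorem setIntegral_inf_add_setIntegral_sdiff (t s : L.DefinableSet A α) :
    μ.setIntegral (t ⊓ s) + μ.setIntegral (t \ s) = μ.setIntegral t := by
  refine Finsupp.lhom_ext fun r c => ?_
  rw [LinearMap.add_apply, setIntegral_single, setIntegral_single, setIntegral_single, ← mul_add,
    ← inf_assoc, ← inf_sdiff_assoc, apply_inf_add_apply_sdiff]

theorem mul_apply_le_setIntegral (v : L.DefinableSet A α →₀ ℝ) {c : ℝ} {t : L.DefinableSet A α}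
    (h : ∀ x ∈ t, c ≤ simpleFunction v x) : c * μ t ≤ μ.setIntegral t v := by
  induction v using Finsupp.induction generalizing c t with
  | zero =>
    rw [map_zero]
    obtain ht | ⟨x, hx⟩ := (t : Set (α → U)).eq_empty_or_nonempty
    · obtain rfl : t = ⊥ := SetLike.coe_injective ht
      rw [apply_bot, mul_zero]
    · exact mul_nonpos_of_nonpos_of_nonneg (by simpa using h x hx) (μ.nonneg' t)
  | single_add s b v _ _ ih =>
    have hinf : (c - b) * μ (t ⊓ s) ≤ μ.setIntegral (t ⊓ s) v := ih fun x hx => by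
      obtain ⟨hxt, hxs⟩ := mem_inf.1 hx
      simpa [SetLike.mem_coe.2 hxs, add_comm b] using h x hxt
    have hsdiff : c * μ (t \ s) ≤ μ.setIntegral (t \ s) v := ih fun x hx => by
      obtain ⟨hxt, hxs⟩ := mem_sdiff.1 hx
      simpa [mt SetLike.mem_coe.1 hxs] using h x hxt
    calc
      c * μ t = b * μ (s ⊓ t) + ((c - b) * μ (t ⊓ s) + c * μ (t \ s)) := by
        rw [← μ.apply_inf_add_apply_sdiff t s, inf_comm s t]
        ring
      _ ≤ b * μ (s ⊓ t) + (μ.setIntegral (t ⊓ s) v + μ.setIntegral (t \ s) v) := by gcongr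
      _ = μ.setIntegral t (Finsupp.single s b + v) := by
        rw [map_add, setIntegral_single, ← LinearMap.add_apply,
          setIntegral_inf_add_setIntegral_sdiff]

theorem integral_nonneg {v : L.DefinableSet A α →₀ ℝ} (h : 0 ≤ simpleFunction v) :
    0 ≤ μ.integral v := by
  simpa only [zero_mul, setIntegral_top] using
    μ.mul_apply_le_setIntegral v (c := 0) (t := ⊤) fun x _ => h x

theorem exists_subset_mul_apply_le_integral {a : ℝ} (ha : 0 ≤ a) {D : Set (α → U)}
    {v : L.DefinableSet A α →₀ ℝ} (h : a • D.indicator 1 ≤ simpleFunction v) :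
    ∃ t : L.DefinableSet A α, D ⊆ t ∧ a * μ t ≤ μ.integral v := by
  let t : L.DefinableSet A α := ⟨_, definable_simpleFunction_preimage v (Ici a)⟩
  have hDt : D ⊆ t := fun x hx => by
    have hax := h x
    rwa [Pi.smul_apply, indicator_of_mem hx, Pi.one_apply, smul_eq_mul, mul_one] at hax
  refine ⟨t, hDt, ?_⟩
  have hv_nonneg (x : α → U) : 0 ≤ simpleFunction v x :=
    (mul_nonneg ha (indicator_nonneg (fun _ _ => zero_le_one) x)).trans (h x)
  have h_indicator : 0 ≤ simpleFunction (v - Finsupp.single t a) := fun x => by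
    by_cases hx : x ∈ (t : Set (α → U))
    · have hax : a ≤ simpleFunction v x := hx
      simpa [hx] using hax
    · simpa [hx] using hv_nonneg x
  simpa using μ.integral_nonneg h_indicator

end Integral

section Extension

theorem exists_apply_eq_of_positive {V : Type*} [AddCommGroup V] [Module ℝ V]
    (e : V →ₗ[ℝ] (α → U) → ℝ) (I : V →ₗ[ℝ] ℝ) (hI : ∀ v, 0 ≤ e v → 0 ≤ I v)
    {o : V} (ho : e o = 1) (hIo : I o = 1) :
    ∃ ω : KeislerMeasure L A α, ∀ v (s : L.DefinableSet A α),
      e v = (s : Set (α → U)).indicator 1 → ω s = I v := by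
  obtain ⟨J, hJ, hIJ⟩ := exists_linearMap_nonneg_extension e
    (simpleFunction : (L.DefinableSet A α →₀ ℝ) →ₗ[ℝ] _) I hI fun w => by
      obtain ⟨c, hc⟩ := exists_simpleFunction_le w
      exact ⟨c • o, by rwa [map_smul, ho]⟩
  have hJ_single {v : V} {s : L.DefinableSet A α} (h : e v = (s : Set (α → U)).indicator 1) :
      J (Finsupp.single s 1) = I v :=
    (hIJ v _ (by rw [h, simpleFunction_single, one_smul])).symm
  refine ⟨⟨fun s => J (Finsupp.single s 1), fun s => hJ _ ?_, ?_, fun s t hst => ?_⟩,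
    fun v s => hJ_single⟩
  · rw [simpleFunction_single, one_smul]
    exact indicator_nonneg fun _ _ => zero_le_one
  · rw [hJ_single (v := o) (by rw [ho, coe_top, indicator_univ]), hIo]
  · have hst' : Disjoint (s : Set (α → U)) t := by
      rw [disjoint_iff_inter_eq_empty, ← coe_inf, hst.eq_bot, coe_bot]
    have h_sup := hIJ 0
      (Finsupp.single (s ⊔ t) 1 - (Finsupp.single s 1 + Finsupp.single t 1)) (by
        simp [indicator_union_of_disjoint hst', Pi.add_def])
    rw [map_zero, map_sub, map_add, eq_comm, sub_eq_zero] at h_sup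
    exact h_sup

variable (μ : KeislerMeasure L A α)

theorem integral_add_mul_nonneg (h : A ⊆ B) {D : L.DefinableSet B α} {c : ℝ}
    (hinner : ∀ s : L.DefinableSet A α, s.ofSubset h ≤ D → μ s ≤ c)
    (houter : ∀ t : L.DefinableSet A α, D ≤ t.ofSubset h → c ≤ μ t)
    {v : L.DefinableSet A α →₀ ℝ} {a : ℝ}
    (hva : 0 ≤ simpleFunction v + a • (D : Set (α → U)).indicator 1) :
    0 ≤ μ.integral v + a * c := by
  obtain ha | ha := le_total a 0
  · obtain ⟨t, hDt, ht⟩ := μ.exists_subset_mul_apply_le_integral (neg_nonneg.2 ha)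
      (D := D) (v := v) (by rwa [neg_smul, neg_le_iff_add_nonneg])
    have := mul_le_mul_of_nonneg_left (houter t hDt) (neg_nonneg.2 ha)
    linarith
  · obtain ⟨r, hDr, hr⟩ := μ.exists_subset_mul_apply_le_integral ha (D := (D : Set (α → U))ᶜ)
      (v := v + Finsupp.single ⊤ a) fun x => by
        have := hva x
        by_cases hx : x ∈ (D : Set (α → U)) <;> simp_all
    have hrc := hinner rᶜ (compl_subset_comm.1 hDr)
    rw [apply_compl] at hrc
    rw [map_add, integral_single, μ.top'] at hr
    have := mul_le_mul_of_nonneg_left hrc ha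
    linarith

theorem exists_extension_apply_eq (h : A ⊆ B) (D : L.DefinableSet B α) {c : ℝ}
    (hinner : ∀ s : L.DefinableSet A α, s.ofSubset h ≤ D → μ s ≤ c)
    (houter : ∀ t : L.DefinableSet A α, D ≤ t.ofSubset h → c ≤ μ t) :
    ∃ μ' : KeislerMeasure L B α, μ'.restrict h = μ ∧ μ' D = c := by
  let e : (L.DefinableSet A α →₀ ℝ) × ℝ →ₗ[ℝ] (α → U) → ℝ :=
    simpleFunction.coprod (LinearMap.toSpanSingleton ℝ _ ((D : Set (α → U)).indicator 1))
  let I : (L.DefinableSet A α →₀ ℝ) × ℝ →ₗ[ℝ] ℝ :=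
    μ.integral.coprod (LinearMap.toSpanSingleton ℝ ℝ c)
  obtain ⟨μ', hμ'⟩ := exists_apply_eq_of_positive (L := L) (A := B) e I
    (fun _ hp => μ.integral_add_mul_nonneg h hinner houter hp) (o := (Finsupp.single ⊤ 1, 0))
    (by simp [e]) (by simp [I, μ.top'])
  refine ⟨μ', ?_, ?_⟩
  · ext s
    refine (hμ' (Finsupp.single s 1, 0) (s.ofSubset h) ?_).trans (by simp [I])
    simp only [e, LinearMap.coprod_apply, simpleFunction_single, map_zero, add_zero, one_smul]
    rfl
  · exact (hμ' (0, 1) D (by simp [e])).trans (by simp [I])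

theorem exists_restrict_eq (h : A ⊆ B) : ∃ μ' : KeislerMeasure L B α, μ'.restrict h = μ := by
  obtain ⟨μ', hμ', -⟩ := μ.exists_extension_apply_eq h ⊤ (c := 1) (fun s _ => μ.apply_le_one s)
    fun t ht => by
      have ht_top : t = ⊤ := top_le_iff.1 ht
      rw [ht_top, μ.top']
  exact ⟨μ', hμ'⟩

variable {μ}

theorem HasUniqueGlobalExtension.of_restrict (h : A ⊆ B) {μ : KeislerMeasure L B α}
    (hμ : (μ.restrict h).HasUniqueGlobalExtension) : μ.HasUniqueGlobalExtension := by
  obtain ⟨μ', hμ'⟩ := μ.exists_restrict_eq (subset_univ B)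
  have restrict_eq {ρ : KeislerMeasure L univ α} (hρ : ρ.restrict (subset_univ B) = μ) :
      ρ.restrict (subset_univ A) = μ.restrict h := hρ ▸ rfl
  exact ⟨μ', hμ', fun ρ hρ => hμ.unique (restrict_eq hρ) (restrict_eq hμ')⟩

theorem HasUniqueGlobalExtension.exists_approx (hμ : μ.HasUniqueGlobalExtension)
    (D : L.DefinableSet (univ : Set U) α) {ε : ℝ} (hε : 0 < ε) :
    ∃ s t : L.DefinableSet A α, s.ofSubset (subset_univ A) ≤ D ∧
      D ≤ t.ofSubset (subset_univ A) ∧ μ t - μ s < ε := by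
  have hA := subset_univ A
  by_contra! hgap
  obtain ⟨c, hinner, houter⟩ : (upperBounds ((μ · + ε) '' {s | s.ofSubset hA ≤ D}) ∩
      lowerBounds (μ '' {t | D ≤ t.ofSubset hA})).Nonempty := by
    refine exists_between_of_forall_le ⟨_, ⊥, fun _ hx => hx.elim, rfl⟩
      ⟨_, ⊤, fun _ _ => trivial, rfl⟩ ?_
    rintro _ ⟨s, hs, rfl⟩ _ ⟨t, ht, rfl⟩
    exact le_sub_iff_add_le'.1 (hgap s t hs ht)
  rw [mem_upperBounds, forall_mem_image] at hinner
  rw [mem_lowerBounds, forall_mem_image] at houter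
  obtain ⟨μ₁, hμ₁, h₁⟩ := μ.exists_extension_apply_eq hA D (c := c - ε)
    (fun s hs => le_sub_iff_add_le.2 (hinner hs)) fun t ht => by linarith [houter ht]
  obtain ⟨μ₂, hμ₂, h₂⟩ := μ.exists_extension_apply_eq hA D (c := c)
    (fun s hs => by linarith [hinner hs]) fun t ht => houter ht
  rw [hμ.unique hμ₁ hμ₂, h₂] at h₁
  linarith

theorem HasUniqueGlobalExtension.eq_mul_of_monotone {μ' : KeislerMeasure L (univ : Set U) α}
    (hμ : (μ'.restrict (subset_univ A)).HasUniqueGlobalExtension)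
    {f : L.DefinableSet (univ : Set U) α → ℝ} (hf : Monotone f) {c : ℝ}
    (hfc : ∀ s : L.DefinableSet A α,
      f (s.ofSubset (subset_univ A)) = c * μ' (s.ofSubset (subset_univ A)))
    (D : L.DefinableSet (univ : Set U) α) : f D = c * μ' D := by
  have hA := subset_univ A
  have hc : 0 ≤ c := by
    have hbot : f ⊥ = 0 := (hfc ⊥).trans (mul_eq_zero_of_right c μ'.apply_bot)
    have htop : f ⊤ = c := (hfc ⊤).trans ((congrArg (c * ·) μ'.top').trans (mul_one c))
    exact hbot ▸ htop ▸ hf bot_le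
  refine eq_of_forall_dist_le fun ε hε => ?_
  obtain ⟨s, t, hs, ht, hst⟩ := hμ.exists_approx D (div_pos hε (by positivity : 0 < c + 1))
  have hgap : c * (μ' (t.ofSubset hA) - μ' (s.ofSubset hA)) ≤ ε := by
    have hst' := (lt_div_iff₀ (by positivity)).1 hst
    have hmono : μ' (s.ofSubset hA) ≤ μ' (t.ofSubset hA) := μ'.apply_mono (hs.trans ht)
    change (μ' (t.ofSubset hA) - μ' (s.ofSubset hA)) * (c + 1) < ε at hst'
    linarith
  have hfs := hf hs
  have hft := hf ht
  rw [hfc] at hfs hft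
  have hμs := mul_le_mul_of_nonneg_left (μ'.apply_mono hs) hc
  have hμt := mul_le_mul_of_nonneg_left (μ'.apply_mono ht) hc
  rw [Real.dist_eq, abs_sub_le_iff]
  constructor <;> linarith

end Extension

section Rectangle

theorem rectangle_mono {s s' : L.DefinableSet A α} {t t' : L.DefinableSet A β} (hs : s ≤ s')
    (ht : t ≤ t') : s.rectangle t ≤ s'.rectangle t' :=
  fun _ hz => ⟨hs hz.1, ht hz.2⟩

theorem rectangle_top_top : (⊤ : L.DefinableSet A α).rectangle (⊤ : L.DefinableSet A β) = ⊤ :=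
  top_le_iff.1 fun _ _ => ⟨trivial, trivial⟩

theorem indicator_rectangle (s : L.DefinableSet A α) (t : L.DefinableSet A β) (x : α → U)
    (y : β → U) : (s.rectangle t : Set (α ⊕ β → U)).indicator (1 : (α ⊕ β → U) → ℝ)
      (Sum.elim x y) = (s : Set (α → U)).indicator 1 x * (t : Set (β → U)).indicator 1 y :=
  indicator_prod_one (s := (s : Set (α → U))) (t := (t : Set (β → U)))

theorem inf_rectangle_sup (E : L.DefinableSet A (α ⊕ β)) (s : L.DefinableSet A α)
    (t t' : L.DefinableSet A β) :
    E ⊓ s.rectangle (t ⊔ t') = E ⊓ s.rectangle t ⊔ E ⊓ s.rectangle t' := by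
  rw [← inf_sup_left]
  exact congrArg _ (SetLike.coe_injective <| Set.ext fun _ => and_or_left)

theorem disjoint_rectangle {s s' : L.DefinableSet A α} {t t' : L.DefinableSet A β}
    (h : Disjoint t t') : Disjoint (s.rectangle t) (s'.rectangle t') := by
  rw [disjoint_iff_inf_le] at h ⊢
  exact fun z hz => h (x := z ∘ Sum.inr) ⟨hz.1.2, hz.2.2⟩

theorem apply_inf_rectangle_sup (ω : KeislerMeasure L A (α ⊕ β)) (E : L.DefinableSet A (α ⊕ β))
    (s : L.DefinableSet A α) {T T' : L.DefinableSet A β} (h : Disjoint T T') :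
    ω (E ⊓ s.rectangle (T ⊔ T')) = ω (E ⊓ s.rectangle T) + ω (E ⊓ s.rectangle T') := by
  rw [inf_rectangle_sup, ω.sup' _ _ ((disjoint_rectangle h).mono inf_le_right inf_le_right)]

end Rectangle

section SeparatedAmalgam

/-- The real function `(x, y) ↦ ∑ i, cᵢ 1_{sᵢ × tᵢ}(x, y)` represented by a formal linear
combination of rectangles. -/
noncomputable def rectangleFunction :
    (L.DefinableSet A α × L.DefinableSet A β →₀ ℝ) →ₗ[ℝ] (α ⊕ β → U) → ℝ :=
  Finsupp.linearCombination ℝ fun p => (p.1.rectangle p.2 : Set (α ⊕ β → U)).indicator 1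

/-- The product integral `∑ i, cᵢ μ(sᵢ) ν(tᵢ)` of a formal linear combination of rectangles. -/
noncomputable def productIntegral (μ : KeislerMeasure L A α) (ν : KeislerMeasure L A β) :
    (L.DefinableSet A α × L.DefinableSet A β →₀ ℝ) →ₗ[ℝ] ℝ :=
  Finsupp.linearCombination ℝ fun p => μ p.1 * ν p.2

theorem productIntegral_nonneg (μ : KeislerMeasure L A α) (ν : KeislerMeasure L A β)
    {v : L.DefinableSet A α × L.DefinableSet A β →₀ ℝ} (hv : 0 ≤ rectangleFunction v) :
    0 ≤ productIntegral μ ν v := by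
  let fibre (y : β → U) :
      (L.DefinableSet A α × L.DefinableSet A β →₀ ℝ) →ₗ[ℝ] L.DefinableSet A α →₀ ℝ :=
    Finsupp.linearCombination ℝ fun p => Finsupp.single p.1 ((p.2 : Set (β → U)).indicator 1 y)
  let marginal : (L.DefinableSet A α × L.DefinableSet A β →₀ ℝ) →ₗ[ℝ] L.DefinableSet A β →₀ ℝ :=
    Finsupp.linearCombination ℝ fun p => Finsupp.single p.2 (μ p.1)
  have simpleFunction_fibre (x : α → U) (y : β → U) :
      LinearMap.proj x ∘ₗ simpleFunction ∘ₗ fibre y =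
        LinearMap.proj (Sum.elim x y) ∘ₗ rectangleFunction :=
    Finsupp.lhom_ext fun p c => by
      simp [fibre, rectangleFunction, indicator_rectangle, mul_comm, mul_left_comm,
        -Finsupp.single_mul]
  have simpleFunction_marginal (y : β → U) :
      LinearMap.proj y ∘ₗ simpleFunction ∘ₗ marginal = μ.integral ∘ₗ fibre y :=
    Finsupp.lhom_ext fun p c => by
      simp [marginal, fibre, mul_comm, mul_left_comm, mul_assoc, -Finsupp.single_mul]
  have integral_marginal : ν.integral ∘ₗ marginal = productIntegral μ ν :=
    Finsupp.lhom_ext fun p c => by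
      simp [marginal, productIntegral, mul_assoc, -Finsupp.single_mul]
  rw [← integral_marginal]
  refine ν.integral_nonneg fun y => ?_
  refine (μ.integral_nonneg fun x => ?_).trans_eq
    (LinearMap.congr_fun (simpleFunction_marginal y) v).symm
  exact (hv _).trans_eq (LinearMap.congr_fun (simpleFunction_fibre x y) v).symm

theorem exists_isSeparatedAmalgam (μ : KeislerMeasure L A α) (ν : KeislerMeasure L A β) :
    ∃ ω, μ.IsSeparatedAmalgam ν ω := by
  obtain ⟨ω, hω⟩ := exists_apply_eq_of_positive (L := L) (A := A) rectangleFunction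
    (productIntegral μ ν) (fun _ => productIntegral_nonneg μ ν) (o := Finsupp.single (⊤, ⊤) 1)
    (by simp [rectangleFunction, rectangle_top_top]) (by simp [productIntegral, μ.top', ν.top'])
  refine ⟨ω, fun s t => ?_⟩
  rw [hω (Finsupp.single (s, t) 1) _ (by simp [rectangleFunction])]
  simp [productIntegral]

theorem HasUniqueGlobalExtension.exists_uniform_approx {κ : Cardinal.{w}}
    (hκ : Cardinal.aleph0 < κ) (hU : L.IsSaturated U κ) (hA : Cardinal.mk A < κ)
    {μ : KeislerMeasure L A α} (hμ : μ.HasUniqueGlobalExtension)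
    (E : L.DefinableSet B (α ⊕ β)) {ε : ℝ} (hε : 0 < ε) :
    ∃ F : Finset (L.DefinableSet A α × L.DefinableSet A α), (∀ k ∈ F, μ k.2 - μ k.1 < ε) ∧
      ∀ y : β → U, ∃ k ∈ F, y ∈ fiberBetween (k.1 : Set (α → U)) k.2 (E : Set (α ⊕ β → U)) := by
  -- Saturation realizes finite tuples over small sets only, so the finitely many parameters and
  -- variables on which `E` depends are isolated first.
  obtain ⟨C, -, hC⟩ := definable_iff_finitely_definable.1 E.2
  obtain ⟨S, T, W, hW, hWE⟩ := exists_finset_preimage_eq_of_definable hC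
  let W' : Set (α ⊕ T → U) := (fun z => z ∘ Sum.map (↑) id) ⁻¹' W
  have hW' : (C : Set U).Definable L W' := hW.preimage_comp (Sum.map ((↑) : S → α) id)
  have hAC : Cardinal.mk (A ∪ C : Set U) < κ :=
    (Cardinal.mk_union_le _ _).trans_lt
      (Cardinal.add_lt_of_lt hκ.le hA ((Cardinal.lt_aleph0_of_finite C).trans hκ))
  obtain ⟨F, hF⟩ := hU.exists_finset_cover hAC
    (ι := {k : L.DefinableSet A α × L.DefinableSet A α // μ k.2 - μ k.1 < ε})
    (Q := fun k => fiberBetween (k.1.1 : Set (α → U)) k.1.2 W')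
    (fun k => definable_fiberBetween (k.1.1.2.mono subset_union_left)
      (k.1.2.2.mono subset_union_left) (hW'.mono subset_union_right)) fun y => by
        obtain ⟨s, t, hs, ht, hst⟩ :=
          hμ.exists_approx ⟨_, definable_univ_setOf_sumElim_mem hW' y⟩ hε
        exact ⟨⟨(s, t), hst⟩, fun x => ⟨fun h => hs h, fun h => ht h⟩⟩
  refine ⟨F.map (Function.Embedding.subtype _), ?_, fun y => ?_⟩
  · exact Finset.forall_mem_map.2 fun k _ => k.2
  · obtain ⟨k, hk, hy⟩ := hF (y ∘ (↑))
    refine ⟨k, Finset.mem_map_of_mem _ hk, fun x => ?_⟩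
    have hx : Sum.elim x y ∈ (E : Set (α ⊕ β → U)) ↔ Sum.elim x (y ∘ (↑)) ∈ W' := by
      rw [show (E : Set (α ⊕ β → U)) = _ from hWE.symm]
      simp only [W', mem_preimage, Sum.elim_comp_map, Function.comp_id]
    rw [hx]
    exact hy x

variable {μ : KeislerMeasure L A α} {ν : KeislerMeasure L A β}
  {ω ω' : KeislerMeasure L A (α ⊕ β)} {E : L.DefinableSet A (α ⊕ β)}
  {s t : L.DefinableSet A α} {T : L.DefinableSet A β}

theorem IsSeparatedAmalgam.apply_inf_rectangle_le (hω : μ.IsSeparatedAmalgam ν ω)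
    (hT : (T : Set (β → U)) ⊆ fiberBetween (s : Set (α → U)) t (E : Set (α ⊕ β → U))) :
    ω (E ⊓ rectangle ⊤ T) ≤ μ t * ν T := by
  rw [← hω]
  refine ω.apply_mono fun z hz => ⟨(hT hz.2.2 _).2 ?_, hz.2.2⟩
  rw [Sum.elim_comp_inl_inr]
  exact hz.1

theorem IsSeparatedAmalgam.le_apply_inf_rectangle (hω : μ.IsSeparatedAmalgam ν ω)
    (hT : (T : Set (β → U)) ⊆ fiberBetween (s : Set (α → U)) t (E : Set (α ⊕ β → U))) :
    μ s * ν T ≤ ω (E ⊓ rectangle ⊤ T) := by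
  rw [← hω]
  refine ω.apply_mono fun z hz => ⟨?_, trivial, hz.2⟩
  rw [← Sum.elim_comp_inl_inr z]
  exact (hT hz.2 _).1 hz.1

theorem IsSeparatedAmalgam.apply_inf_rectangle_le_add (hω : μ.IsSeparatedAmalgam ν ω)
    (hω' : μ.IsSeparatedAmalgam ν ω')
    (hT : (T : Set (β → U)) ⊆ fiberBetween (s : Set (α → U)) t (E : Set (α ⊕ β → U)))
    {ε : ℝ} (hst : μ t - μ s ≤ ε) :
    ω (E ⊓ rectangle ⊤ T) ≤ ω' (E ⊓ rectangle ⊤ T) + ε * ν T := by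
  calc
    ω (E ⊓ rectangle ⊤ T) ≤ μ t * ν T := hω.apply_inf_rectangle_le hT
    _ = μ s * ν T + (μ t - μ s) * ν T := by ring
    _ ≤ ω' (E ⊓ rectangle ⊤ T) + ε * ν T :=
      add_le_add (hω'.le_apply_inf_rectangle hT) (mul_le_mul_of_nonneg_right hst (ν.nonneg' T))

theorem IsSeparatedAmalgam.restrict (h : A ⊆ B) {μ : KeislerMeasure L B α}
    {ν : KeislerMeasure L B β} {ω : KeislerMeasure L B (α ⊕ β)} (hω : μ.IsSeparatedAmalgam ν ω) :
    (μ.restrict h).IsSeparatedAmalgam (ν.restrict h) (ω.restrict h) :=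
  fun s t => hω (s.ofSubset h) (t.ofSubset h)

theorem IsSeparatedAmalgam.apply_le_apply {κ : Cardinal.{w}} (hκ : Cardinal.aleph0 < κ)
    (hU : L.IsSaturated U κ) (hAB : A ⊆ B) (hA : Cardinal.mk A < κ)
    {μ : KeislerMeasure L B α} (hμ : (μ.restrict hAB).HasUniqueGlobalExtension)
    {ν : KeislerMeasure L B β} {ω ω' : KeislerMeasure L B (α ⊕ β)}
    (hω : μ.IsSeparatedAmalgam ν ω) (hω' : μ.IsSeparatedAmalgam ν ω')
    (E : L.DefinableSet B (α ⊕ β)) : ω E ≤ ω' E := by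
  refine le_of_forall_pos_le_add fun ε hε => ?_
  obtain ⟨F, hFε, hF⟩ := hμ.exists_uniform_approx hκ hU hA E hε
  let Q (k : L.DefinableSet A α × L.DefinableSet A α) : L.DefinableSet B β :=
    ⟨_, definable_fiberBetween (k.1.2.mono hAB) (k.2.2.mono hAB) E.2⟩
  have htop : (⊤ : L.DefinableSet B β) ≤ F.sup Q := fun y _ => by
    obtain ⟨k, hk, hy⟩ := hF y
    exact Finset.le_sup (f := Q) hk hy
  have hE_top : ω (E ⊓ rectangle ⊤ ⊤) ≤ ω' (E ⊓ rectangle ⊤ ⊤) + ε * ν ⊤ := by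
    refine induction_of_le_finset_sup
      (P := fun T => ω (E ⊓ rectangle ⊤ T) ≤ ω' (E ⊓ rectangle ⊤ T) + ε * ν T)
      ?_ (fun T T' hTT' hT hT' => ?_) (fun k hk T hT => ?_) htop
    · have hbot : E ⊓ rectangle ⊤ ⊥ = ⊥ := le_bot_iff.1 fun _ hz => hz.2.2
      rw [hbot, apply_bot, apply_bot, apply_bot, mul_zero, add_zero]
    · rw [apply_inf_rectangle_sup _ _ _ hTT', apply_inf_rectangle_sup _ _ _ hTT',
        ν.sup' _ _ hTT']
      linarith
    · exact hω.apply_inf_rectangle_le_add hω' (s := k.1.ofSubset hAB) (t := k.2.ofSubset hAB)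
        hT (hFε k hk).le
  rwa [rectangle_top_top, inf_top_eq, ν.top', mul_one] at hE_top

theorem IsSeparatedAmalgam.unique {κ : Cardinal.{w}} (hκ : Cardinal.aleph0 < κ)
    (hU : L.IsSaturated U κ) (hAB : A ⊆ B) (hA : Cardinal.mk A < κ)
    {μ : KeislerMeasure L B α} (hμ : (μ.restrict hAB).HasUniqueGlobalExtension)
    {ν : KeislerMeasure L B β} {ω ω' : KeislerMeasure L B (α ⊕ β)}
    (hω : μ.IsSeparatedAmalgam ν ω) (hω' : μ.IsSeparatedAmalgam ν ω') : ω = ω' := by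
  ext E
  exact le_antisymm (hω.apply_le_apply hκ hU hAB hA hμ hω' E)
    (hω'.apply_le_apply hκ hU hAB hA hμ hω E)

theorem IsSeparatedAmalgam.of_restrict {μ' : KeislerMeasure L (univ : Set U) α}
    {ν' : KeislerMeasure L (univ : Set U) β} {ω' : KeislerMeasure L (univ : Set U) (α ⊕ β)}
    (hμ : (μ'.restrict (subset_univ A)).HasUniqueGlobalExtension)
    (hν : (ν'.restrict (subset_univ A)).HasUniqueGlobalExtension)
    (hω : (μ'.restrict (subset_univ A)).IsSeparatedAmalgam (ν'.restrict (subset_univ A))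
      (ω'.restrict (subset_univ A))) :
    μ'.IsSeparatedAmalgam ν' ω' := by
  have hmono : Monotone ω' := ω'.apply_mono
  have apply_rectangle_ofSubset (D : L.DefinableSet univ α) (t : L.DefinableSet A β) :
      ω' (D.rectangle (t.ofSubset (subset_univ A))) = ν' (t.ofSubset (subset_univ A)) * μ' D :=
    hμ.eq_mul_of_monotone (f := fun D => ω' (D.rectangle (t.ofSubset (subset_univ A))))
      (fun _ _ h => hmono (rectangle_mono h le_rfl))
      (fun s => (hω s t).trans (mul_comm _ _)) D
  intro D₁ D₂
  exact hν.eq_mul_of_monotone (f := fun D => ω' (D₁.rectangle D))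
    (fun _ _ h => hmono (rectangle_mono le_rfl h))
    (fun t => (apply_rectangle_ofSubset D₁ t).trans (mul_comm _ _)) D₂

theorem IsSeparatedAmalgam.hasUniqueGlobalExtension {κ : Cardinal.{w}}
    (hκ : Cardinal.aleph0 < κ) (hU : L.IsSaturated U κ) (hA : Cardinal.mk A < κ)
    (hω : μ.IsSeparatedAmalgam ν ω) (hμ : μ.HasUniqueGlobalExtension)
    (hν : ν.HasUniqueGlobalExtension) : ω.HasUniqueGlobalExtension := by
  obtain ⟨ω₀, rfl⟩ := ω.exists_restrict_eq (subset_univ A)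
  obtain ⟨μ', rfl⟩ := hμ.exists
  obtain ⟨ν', rfl⟩ := hν.exists
  exact ⟨ω₀, rfl, fun ρ hρ => IsSeparatedAmalgam.unique hκ hU (subset_univ A) hA hμ
    (.of_restrict hμ hν (hρ ▸ hω)) (.of_restrict hμ hν hω)⟩

end SeparatedAmalgam

end FirstOrder.Language.KeislerMeasure

open FirstOrder.Language FirstOrder.Language.KeislerMeasure in
theorem mainTheorem9 {L : FirstOrder.Language.{u, v}} {U : Type w} [L.Structure U]
    (κ : Cardinal.{w}) (hκ : Cardinal.aleph0 < κ)
    (hL : Cardinal.lift.{w} L.card < Cardinal.lift.{max u v} κ)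
    (hU : L.IsSaturated U κ)
    (M : L.ElementarySubstructure U) {α : Type*} {β : Type*}
    (μ : L.KeislerMeasure (M : Set U) α) (ν : L.KeislerMeasure (M : Set U) β)
    (hμ : μ.IsSmooth κ) :
    (∃! ω : L.KeislerMeasure (M : Set U) (α ⊕ β), μ.IsSeparatedAmalgam ν ω) ∧
      (ν.IsSmooth κ →
        ∀ ω : L.KeislerMeasure (M : Set U) (α ⊕ β),
          μ.IsSeparatedAmalgam ν ω → ω.IsSmooth κ) := by
  obtain ⟨-, M₀, hM₀, hM₀κ, hμ₀⟩ := hμ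
  constructor
  · obtain ⟨ω, hω⟩ := μ.exists_isSeparatedAmalgam ν
    exact ⟨ω, hω, fun ω' hω' => IsSeparatedAmalgam.unique hκ hU hM₀ hM₀κ hμ₀ hω' hω⟩
  · rintro ⟨-, M₁, hM₁, hM₁κ, hν₁⟩ ω hω
    obtain ⟨N, hN, hNM, hNκ⟩ := exists_small_elementarySubstructure_between hκ hL M
      (union_subset hM₀ hM₁)
      ((Cardinal.mk_union_le _ _).trans_lt (Cardinal.add_lt_of_lt hκ.le hM₀κ hM₁κ))
    have hμN : (μ.restrict hNM).HasUniqueGlobalExtension :=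
      .of_restrict (subset_union_left.trans hN) hμ₀
    have hνN : (ν.restrict hNM).HasUniqueGlobalExtension :=
      .of_restrict (subset_union_right.trans hN) hν₁
    have hωN : (ω.restrict hNM).HasUniqueGlobalExtension :=
      (hω.restrict hNM).hasUniqueGlobalExtension hκ hU hNκ hμN hνN
    exact ⟨hωN.of_restrict, N, hNM, hNκ, hωN⟩
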